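/- Let $X$ and $Y$ be separable Banach spaces (real or complex). Let $\mathcal L(X,Y)$ be the space of bounded linear operators, and let $\mathrm{Subs}(X)$ be the set of closed infinite-dimensional subspaces of $X$. An operator $T\in\mathcal L(X,Y)$ is strictly singular, $T\in\mathcal{SS}(X,Y)$, if $T|_Z$ is not an isomorphism onto its image for any $Z\in\mathrm{Subs}(X)$. Let $\mathcal B(\mathcal L(X,Y))=\{T:\|T\|\le 1\}$ and $\mathcal B(\mathcal{SS}(X,Y))=\mathcal{SS}(X,Y)\cap\mathcal B(\mathcal L(X,Y))$. The Schreier families $\mathcal S_\xi$ ($\xi<\omega_1$) of finite subsets of $\mathbb N=\{1,2,\dots\}$ are defined by $\mathcal S_0=\{\{n\}:n\in\mathbb N\}\cup\{\emptyset\}$; $\mathcal S_{\xi+1}=\{\bigcup_{i=1}^nF_i: n\ge 1,\ n\le F_1<\dots<F_n,\ F_i\in\mathcal S_\xi\}\cup\{\emptyset\}$ (if some $F_i$ are empty, the order conditions concern only the nonempty ones); and, for limit $\xi$, $\mathcal S_\xi=\bigcup_{n\ge1}\{F\in\mathcal S_{\xi_n}:n\le F\}$, where $(\xi_n)_{n\ge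 1}$ is a fixed increasing sequence of ordinals below $\xi$ with limit $\xi$. Any choice of these sequences is allowed. For $1\le\xi<\omega_1$, $T\in\mathcal L(X,Y)$ is $\mathcal S_\xi$-strictly singular, $T\in\mathcal{SS}_\xi(X,Y)$, if for every $\varepsilon>0$ and every normalized basic sequence $(x_n)_{n\ge1}$ in $X$ there are $F\in\mathcal S_\xi$ and a nonzero $x$ in the closed linear span of $\{x_n:n\in F\}$ with $\|Tx\|<\varepsilon\|x\|$. Put $$i(\mathcal{SS}(X,Y))=\sup_{T\in\mathcal{SS}(X,Y)}\inf\{\xi: 1\le\xi<\omega_1,\ T\in\mathcal{SS}_\xi(X,Y)\},\qquad \inf\emptyset:=\omega_1 .$$ **Proposition.** Suppose that for every $R\in\mathcal L(X,Y)$, $$R\in\mathcal{SS}(X,Y)\iff\text{for every }\varepsilon>0\text{ there is }Z\in\mathrm{Subs}(X)\text{ with }\|R|_Z\|<\varepsilon .$$ Then $\mathcal B(\mathcal{SS}(X,Y))$ is a Borel subset of $\mathcal B(\mathcal L(X,Y))$ in the strong operator topology (the topology of pointwise convergence), and $i(\mathcal{SS}(X,Y))<\omega_1$. -/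

import Mathlib

open scoped Ordinal

noncomputable section

/-! ### Schreier families -/

/-- `IsFundamentalSystem s`: for every countable limit ordinal `ξ`, the sequence
`s ξ 1, s ξ 2, …` is an increasing sequence of ordinals below `ξ` with limit `ξ`.
(Strict monotonicity is not required.) -/
def IsFundamentalSystem (s : Ordinal.{0} → ℕ+ → Ordinal.{0}) : Prop :=
  ∀ ξ : Ordinal.{0}, ξ < ω₁ → Order.IsSuccLimit ξ →
    Monotone (s ξ) ∧ (∀ n, s ξ n < ξ) ∧ IsLUB (Set.range (s ξ)) ξ

/-- The family `S_0`: the singletons and the empty set. -/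
def schreierZero : Set (Finset ℕ+) :=
  {F | ∃ n : ℕ+, F = {n}} ∪ {∅}

/-- The successor step: the unions `F_1 ∪ ⋯ ∪ F_n` with `n ≤ F_1 < ⋯ < F_n` and each `F_i` in the
given family, together with the empty set. If some `F_i` is empty, the order conditions are
understood for the elements of all the sets, i.e. they only concern the nonempty `F_i`. -/
def schreierSucc (S : Set (Finset ℕ+)) : Set (Finset ℕ+) :=
  {F | ∃ (n : ℕ+) (G : Fin n → Finset ℕ+),
      (∀ i, G i ∈ S) ∧
      (∀ i, ∀ a ∈ G i, n ≤ a) ∧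
      (∀ i j, i < j → ∀ a ∈ G i, ∀ b ∈ G j, a < b) ∧
      F = Finset.univ.biUnion G} ∪ {∅}

/-- The Schreier family `S_ξ` of finite subsets of `{1, 2, 3, …}`, built along the system `s` of
increasing sequences chosen at limit ordinals. -/
def schreier (s : Ordinal.{0} → ℕ+ → Ordinal.{0}) (ξ : Ordinal.{0}) : Set (Finset ℕ+) :=
  Ordinal.limitRecOn (motive := fun _ => Set (Finset ℕ+)) ξ
    schreierZero
    (fun _ S => schreierSucc S)
    (fun η _ S => {F | ∃ (n : ℕ+) (h : s η n < η), F ∈ S (s η n) h ∧ ∀ a ∈ F, n ≤ a})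

/-- The recursion at `0`. -/
theorem schreier_zero (s : Ordinal.{0} → ℕ+ → Ordinal.{0}) : schreier s 0 = schreierZero :=
  Ordinal.limitRecOn_zero _ _ _

/-- The recursion at successors. -/
theorem schreier_add_one (s : Ordinal.{0} → ℕ+ → Ordinal.{0}) (ξ : Ordinal.{0}) :
    schreier s (ξ + 1) = schreierSucc (schreier s ξ) :=
  Ordinal.limitRecOn_add_one _ _ _ _

/-- The recursion at limits. -/
theorem schreier_limit (s : Ordinal.{0} → ℕ+ → Ordinal.{0}) (ξ : Ordinal.{0})
    (hξ : Order.IsSuccLimit ξ) :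
    schreier s ξ =
      {F | ∃ n : ℕ+, s ξ n < ξ ∧ F ∈ schreier s (s ξ n) ∧ ∀ a ∈ F, n ≤ a} := by
  have h := Ordinal.limitRecOn_limit (motive := fun _ => Set (Finset ℕ+)) ξ
    schreierZero (fun _ S => schreierSucc S)
    (fun η _ S => {F | ∃ (n : ℕ+) (h : s η n < η), F ∈ S (s η n) h ∧ ∀ a ∈ F, n ≤ a}) hξ
  ext F
  unfold schreier
  rw [h]
  simp only [Set.mem_ofPred_eq, exists_prop]

/-! ### Operators -/

section Operators

variable (𝕜 : Type*) [RCLike 𝕜]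
variable {X : Type*} [NormedAddCommGroup X] [NormedSpace 𝕜 X]
variable {Y : Type*} [NormedAddCommGroup Y] [NormedSpace 𝕜 Y]

/-- `Subs(X)`: the closed infinite-dimensional subspaces of `X`. -/
def infDimSubspaces (X : Type*) [NormedAddCommGroup X] [NormedSpace 𝕜 X] :
    Set (Submodule 𝕜 X) :=
  {Z | IsClosed (Z : Set X) ∧ ¬ FiniteDimensional 𝕜 Z}

/-- `[x_n]_{n ∈ A}`: the closed linear span of the vectors `x_n`, `n ∈ A`. -/
def closedSpan (x : ℕ+ → X) (A : Set ℕ+) : Submodule 𝕜 X :=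
  (Submodule.span 𝕜 (x '' A)).topologicalClosure

/-- `(x_n)` is a normalized basic sequence: every `x_n` has norm one and `(x_n)` is a Schauder
basis of its closed linear span. -/
def IsNormalizedBasicSeq (x : ℕ+ → X) : Prop :=
  (∀ n, ‖x n‖ = 1) ∧
  ∃ b : GeneralSchauderBasis ℕ+ 𝕜 (closedSpan 𝕜 x Set.univ) (SummationFilter.conditional ℕ+),
    ∀ n, ((b n : closedSpan 𝕜 x Set.univ) : X) = x n

variable {𝕜}

/-- `T` is strictly singular: its restriction to a (closed) infinite-dimensional subspace is never
an isomorphism, i.e. never a linear homeomorphism onto its image. -/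
def IsStrictlySingular (T : X →L[𝕜] Y) : Prop :=
  ∀ Z ∈ infDimSubspaces 𝕜 X, ¬ Topology.IsEmbedding (T.comp Z.subtypeL)

/-- `T` is `S_ξ`-strictly singular. -/
def IsSchreierSS (s : Ordinal.{0} → ℕ+ → Ordinal.{0}) (ξ : Ordinal.{0}) (T : X →L[𝕜] Y) : Prop :=
  ∀ ε : ℝ, 0 < ε → ∀ x : ℕ+ → X, IsNormalizedBasicSeq 𝕜 x →
    ∃ F ∈ schreier s ξ, ∃ v ∈ closedSpan 𝕜 x (F : Set ℕ+), v ≠ 0 ∧ ‖T v‖ < ε * ‖v‖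

/-- `inf {ξ : T is S_ξ-strictly singular}`, `ξ` ranging over `1 ≤ ξ < ω₁`, with the convention that
the infimum is `ω₁` if there is no such `ξ`. -/
def ssRank (s : Ordinal.{0} → ℕ+ → Ordinal.{0}) (T : X →L[𝕜] Y) : Ordinal.{0} :=
  sInf ({ξ | 1 ≤ ξ ∧ ξ < ω₁ ∧ IsSchreierSS s ξ T} ∪ {ω₁})

variable (𝕜 X Y)

/-- The index `i(SS(X,Y))`: the supremum of `ssRank` over all strictly singular operators. The
family is bounded by `ω₁`, so this is a genuine supremum. -/
def ssIndex (s : Ordinal.{0} → ℕ+ → Ordinal.{0}) : Ordinal.{0} :=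
  ⨆ T : {T : X →L[𝕜] Y // IsStrictlySingular T}, ssRank s T.1

/-- The strong operator topology (pointwise convergence) on the closed unit ball of `L(X,Y)`. -/
abbrev ballSOT : TopologicalSpace (Metric.closedBall (0 : X →L[𝕜] Y) 1) :=
  TopologicalSpace.induced
    (fun T => ContinuousLinearMap.toPointwiseConvergenceCLM 𝕜 (RingHom.id 𝕜) X Y T.1)
    inferInstance

/-- `B(SS(X,Y))`: the strictly singular operators in the closed unit ball of `L(X,Y)`. -/
def ballSS : Set (Metric.closedBall (0 : X →L[𝕜] Y) 1) :=
  {T | IsStrictlySingular T.1}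

end Operators

end

/-!
The strictly singular operators in the unit ball form a set that is both analytic and coanalytic.
An operator is not strictly singular iff it is bounded below on the span of some linearly independent
sequence, and, by hypothesis, it is strictly singular iff for each `n` its norm is at most
`1 / (n + 1)` on the span of some linearly independent sequence. Both conditions project Borel
conditions along the Polish space of sequences in `X`, and the unit ball with the strong operator
topology is a continuous image of a Polish space (`exists_polish_parametrization_closedBall`), so
Souslin's theorem gives that the set is Borel (`measurableSet_ballSS`).

For the index, fix a dense sequence `d` in `X` and `k`, and attach to an operator `T` the finite sets
`E` such that the `d n`, `n ∈ E`, are linearly independent and `T` is bounded below by `1 / k` on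
their span (`IsGoodIndexSet`). If `T` is strictly singular there is no infinite increasing sequence
of such sets, so they have an ordinal rank. As the strictly singular operators form an analytic set
and the conditions are closed in `T`, these ranks, for `T` of norm at most one and all `k`, have a
common countable bound (`exists_uniform_rank_bound`, a boundedness theorem in the style of Kunen and
Martin). If a strictly singular `T` is not `S_ξ`-strictly singular, then `T` is bounded below on the
spans of `(x_n)_{n ∈ F}`, `F ∈ S_ξ`, for some basic sequence; a perturbation of `(x_n)` into the
dense sequence embeds `S_ξ` into the finite sets attached to `T`. Since `S_ξ` has rank at least `ξ`
(`le_rank_schreier`), `ξ` is below the common bound.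
-/

open Set Filter Topology MeasureTheory

/-! ### Schreier families have large rank -/

theorem empty_mem_schreier {s : Ordinal.{0} → ℕ+ → Ordinal.{0}} (hs : IsFundamentalSystem s)
    {ξ : Ordinal.{0}} (hξ : ξ < ω₁) : ∅ ∈ schreier s ξ := by
  induction ξ using Ordinal.limitRecOn with
  | zero => rw [schreier_zero]; exact Or.inr rfl
  | add_one ξ _ => rw [schreier_add_one]; exact Or.inr rfl
  | limit ξ hl ih =>
    rw [schreier_limit s ξ hl]
    have h := (hs ξ hξ hl).2.1 1
    exact ⟨1, h, ih _ h (h.trans hξ), by simp⟩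

theorem singleton_mem_schreier {s : Ordinal.{0} → ℕ+ → Ordinal.{0}} (hs : IsFundamentalSystem s)
    {ξ : Ordinal.{0}} (hξ : ξ < ω₁) (n : ℕ+) : {n} ∈ schreier s ξ := by
  induction ξ using Ordinal.limitRecOn with
  | zero => rw [schreier_zero]; exact Or.inl ⟨n, rfl⟩
  | add_one ξ ih =>
    rw [schreier_add_one]
    refine Or.inl ⟨1, fun _ => {n}, fun _ => ih ((lt_add_one ξ).trans hξ), by simp, ?_, ?_⟩
    · intro i j hij
      have hi := i.2
      have hj := j.2
      simp only [PNat.one_coe] at hi hj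
      omega
    · exact Finset.ext fun a => ⟨fun h => Finset.mem_biUnion.2 ⟨⟨0, by simp⟩, Finset.mem_univ _, h⟩,
        fun h => (Finset.mem_biUnion.1 h).elim fun _ h => h.2⟩
  | limit ξ hl ih =>
    rw [schreier_limit s ξ hl]
    have h := (hs ξ hξ hl).2.1 1
    exact ⟨1, h, ih _ h (h.trans hξ), by simp⟩

theorem insert_mem_schreier_add_one {s : Ordinal.{0} → ℕ+ → Ordinal.{0}}
    (hs : IsFundamentalSystem s) {ξ : Ordinal.{0}} (hξ : ξ < ω₁) {n : ℕ+} (hn : 2 ≤ n)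
    {G : Finset ℕ+} (hG : G ∈ schreier s ξ) (hnG : ∀ a ∈ G, n < a) :
    insert n G ∈ schreier s (ξ + 1) := by
  rw [schreier_add_one]
  refine Or.inl ⟨2, fun i => if (i : ℕ) = 0 then {n} else G, fun i => ?_, fun i a ha => ?_,
    fun i j hij a ha b hb => ?_, ?_⟩
  · dsimp only
    split_ifs
    exacts [singleton_mem_schreier hs hξ n, hG]
  · dsimp only at ha
    split_ifs at ha
    · rwa [Finset.mem_singleton.1 ha]
    · exact hn.trans (hnG a ha).le
  · have hi : (i : ℕ) = 0 := by
      have hj := j.2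
      simp only [PNat.val_ofNat] at hj
      omega
    have hj : (j : ℕ) ≠ 0 := by omega
    simp only [hi, hj, if_true, if_false] at ha hb
    rw [Finset.mem_singleton.1 ha]
    exact hnG b hb
  · refine Finset.ext fun a => ⟨fun h => Finset.mem_biUnion.2 ?_, fun h => ?_⟩
    · rcases Finset.mem_insert.1 h with h | h
      · exact ⟨⟨0, by simp⟩, Finset.mem_univ _, by simpa using h⟩
      · exact ⟨⟨1, by simp⟩, Finset.mem_univ _, by simpa using h⟩
    · obtain ⟨i, -, hi⟩ := Finset.mem_biUnion.1 h
      split_ifs at hi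
      · exact Finset.mem_insert.2 (Or.inl (Finset.mem_singleton.1 hi))
      · exact Finset.mem_insert_of_mem hi

/-- The rank of `S_ξ` under end extension is at least `ξ`, also after discarding the sets that meet
`[1, m)`: an ordinal-valued function that drops at each one-point end extension within the family
is at least `ξ` at `∅`. -/
theorem le_rank_schreier {s : Ordinal.{0} → ℕ+ → Ordinal.{0}} (hs : IsFundamentalSystem s)
    {ξ : Ordinal.{0}} (hξ : ξ < ω₁) (m : ℕ+) (ρ : Finset ℕ+ → Ordinal.{0})
    (hρ : ∀ (F : Finset ℕ+) (b : ℕ+), F ∈ schreier s ξ → insert b F ∈ schreier s ξ →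
      (∀ a ∈ F, a < b) → (∀ a ∈ insert b F, m ≤ a) → ρ (insert b F) < ρ F) :
    ξ ≤ ρ ∅ := by
  induction ξ using Ordinal.limitRecOn generalizing m ρ with
  | zero => exact zero_le
  | add_one ξ ih =>
    have hξ' := (lt_add_one ξ).trans hξ
    -- Fix a first element `n`; the sets `{n} ∪ G` with `n < G ∈ S_ξ` belong to `S_{ξ+1}`.
    set n : ℕ+ := max m 2
    have hn : 2 ≤ n := le_max_right _ _
    have h1 : ξ ≤ ρ (insert n ∅) := by
      refine ih hξ' (n + 1) (fun G => ρ (insert n G)) fun F b hF hbF hlt hle => ?_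
      have hnb : ∀ a ∈ insert b F, n < a := fun a ha => PNat.add_one_le_iff.1 (hle a ha)
      have hnF : ∀ a ∈ F, n < a := fun a ha => hnb a (Finset.mem_insert_of_mem ha)
      rw [Finset.insert_comm]
      refine hρ _ _ (insert_mem_schreier_add_one hs hξ' hn hF hnF) ?_ ?_ ?_
      · rw [Finset.insert_comm]
        exact insert_mem_schreier_add_one hs hξ' hn hbF hnb
      · intro a ha
        rcases Finset.mem_insert.1 ha with rfl | ha
        · exact hnb b (Finset.mem_insert_self _ _)
        · exact hlt a ha
      · intro a ha
        rw [Finset.insert_comm] at ha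
        rcases Finset.mem_insert.1 ha with rfl | ha
        · exact le_max_left _ _
        · exact (le_max_left _ _).trans (hnb a ha).le
    refine Order.add_one_le_of_lt (h1.trans_lt (hρ ∅ n (empty_mem_schreier hs hξ) ?_ (by simp) ?_))
    · exact singleton_mem_schreier hs hξ n
    · intro a ha
      rw [Finset.mem_singleton.1 (show a ∈ ({n} : Finset ℕ+) from ha)]
      exact le_max_left _ _
  | limit ξ hl ih =>
    obtain ⟨-, hlt, hlub⟩ := hs ξ hξ hl
    refine hlub.2 ?_
    rintro _ ⟨n, rfl⟩
    refine ih _ (hlt n) ((hlt n).trans hξ) (max m n) ρ fun F b hF hbF hFb hle => ?_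
    have hmem : ∀ G ∈ schreier s (s ξ n), (∀ a ∈ G, max m n ≤ a) → G ∈ schreier s ξ := by
      intro G hG hGn
      rw [schreier_limit s ξ hl]
      exact ⟨n, hlt n, hG, fun a ha => (le_max_right _ _).trans (hGn a ha)⟩
    exact hρ F b (hmem F hF fun a ha => hle a (Finset.mem_insert_of_mem ha)) (hmem _ hbF hle) hFb
      fun a ha => (le_max_left _ _).trans (hle a ha)

/-! ### Uniform countable bounds for ranks of trees -/

theorem exists_rank_lt_of_countable {α : Type} [Countable α] (r : α → α → Prop)
    [IsWellFounded α r] : ∃ o < ω₁, ∀ a, IsWellFounded.rank r a < o := by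
  have hω : Order.IsSuccLimit ω₁ := Cardinal.isSuccLimit_omega 1
  have h : ∀ a, IsWellFounded.rank r a < ω₁ := by
    intro a
    induction a using IsWellFounded.induction r with
    | ind a ih =>
      rw [IsWellFounded.rank_eq]
      exact Ordinal.iSup_lt_omega_one fun b => hω.succ_lt (ih b.1 b.2)
  refine ⟨⨆ a, Order.succ (IsWellFounded.rank r a),
    Ordinal.iSup_lt_omega_one fun a => hω.succ_lt (h a), fun a => ?_⟩
  exact (Order.lt_succ _).trans_le (Ordinal.le_iSup (fun a => Order.succ (IsWellFounded.rank r a)) a)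

/-- Boundedness for trees of finite sets. Let `good p E` be closed in the parameter `p` and
hereditary in the finite set `E`. If no parameter of an analytic set `A` admits an infinite
increasing sequence of good sets, then the good sets of all `p ∈ A` have ranks below a common
countable ordinal.

With `A` the range of a continuous `f` on the Baire space, finite approximations of the parameter
are carried along with the finite set; the resulting relation on a countable type is well-founded,
since an infinite descent converges to some `α` such that `f α` admits an infinite increasing
sequence of good sets. -/
theorem exists_uniform_rank_bound {P : Type*} [TopologicalSpace P] {A : Set P} (hA : AnalyticSet A)
    (good : P → Finset ℕ → Prop) (hclosed : ∀ E, IsClosed {p | good p E})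
    (hmono : ∀ p E E', E ⊆ E' → good p E' → good p E)
    (hwf : ∀ p ∈ A, ¬ ∃ E : ℕ → Finset ℕ, StrictMono E ∧ ∀ i, good p (E i)) :
    ∃ o < ω₁, ∀ p ∈ A, ∃ ρ : Finset ℕ → Ordinal.{0},
      (∀ E E', E ⊂ E' → good p E' → ρ E' < ρ E) ∧ ∀ E, ρ E < o := by
  rw [AnalyticSet] at hA
  rcases hA with rfl | ⟨f, hf, rfl⟩
  · exact ⟨0, Ordinal.omega_pos 1, by simp⟩
  let r : List ℕ × Finset ℕ → List ℕ × Finset ℕ → Prop := fun N' N =>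
    N.2 ⊂ N'.2 ∧ ∃ α : ℕ → ℕ, N.1 = PiNat.res α N.2.card ∧ N'.1 = PiNat.res α N'.2.card ∧
      good (f α) N'.2
  have hr : IsWellFounded _ r := by
    refine ⟨wellFounded_iff_isEmpty_descending_chain.2 ⟨?_⟩⟩
    refine fun ⟨N, hN⟩ => ?_
    choose hsub α hα hα' hgood using hN
    have hE : StrictMono fun i => (N i).2 := strictMono_nat_of_lt_succ hsub
    have hcard : StrictMono fun i => (N i).2.card :=
      strictMono_nat_of_lt_succ fun i => Finset.card_lt_card (hsub i)
    have hagree : ∀ m n, m ≤ n → α n m = α m m := by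
      intro m n hmn
      induction n, hmn using Nat.le_induction with
      | base => rfl
      | succ n hmn ih =>
        rw [← ih]
        refine (PiNat.res_eq_res.1 ((hα' n).symm.trans (hα (n + 1))) ?_).symm
        exact (Nat.lt_succ_of_le hmn).trans_le (hcard.le_apply (x := n + 1))
    have hlim : Tendsto α atTop (𝓝 fun m => α m m) :=
      tendsto_pi_nhds.2 fun m => tendsto_const_nhds.congr' <|
        (eventually_ge_atTop m).mono fun n hn => (hagree m n hn).symm
    refine hwf _ ⟨fun m => α m m, rfl⟩ ⟨fun i => (N (i + 1)).2, fun i j hij => hE (by simpa using hij),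
      fun i => ?_⟩
    refine (hclosed (N (i + 1)).2).mem_of_tendsto ((hf.tendsto _).comp hlim)
      ((eventually_ge_atTop i).mono fun n hn => ?_)
    exact hmono _ _ _ (hE.monotone (by simpa using hn)) (hgood n)
  obtain ⟨o, ho, hlt⟩ := exists_rank_lt_of_countable r
  refine ⟨o, ho, ?_⟩
  rintro _ ⟨α, rfl⟩
  exact ⟨fun E => IsWellFounded.rank r (PiNat.res α E.card, E),
    fun E E' hEE' hg => IsWellFounded.rank_lt_of_rel ⟨hEE', α, rfl, rfl, hg⟩, fun E => hlt _⟩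

section

variable {𝕜 : Type*} [RCLike 𝕜]
  {X : Type*} [NormedAddCommGroup X] [NormedSpace 𝕜 X]
  {Y : Type*} [NormedAddCommGroup Y] [NormedSpace 𝕜 Y]

/-! ### Strict singularity in terms of linearly independent sequences -/

theorem not_finiteDimensional_of_linearIndependent_mem {ι : Type*} [Infinite ι] {x : ι → X}
    (hx : LinearIndependent 𝕜 x) {Z : Submodule 𝕜 X} (hZ : ∀ i, x i ∈ Z) :
    ¬ FiniteDimensional 𝕜 Z := by
  intro h
  have hli : LinearIndependent 𝕜 fun i => (⟨x i, hZ i⟩ : Z) :=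
    LinearIndependent.of_comp Z.subtype hx
  have := hli.finite
  exact not_finite ι

theorem topologicalClosure_span_range_mem_infDimSubspaces {ι : Type*} [Infinite ι] {x : ι → X}
    (hx : LinearIndependent 𝕜 x) :
    (Submodule.span 𝕜 (range x)).topologicalClosure ∈ infDimSubspaces 𝕜 X :=
  ⟨Submodule.isClosed_topologicalClosure _, not_finiteDimensional_of_linearIndependent_mem hx
    fun i => Submodule.le_topologicalClosure _ (Submodule.subset_span ⟨i, rfl⟩)⟩

theorem forall_mem_topologicalClosure_span_le {ι : Type*} {x : ι → X} {f g : X → ℝ}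
    (hf : Continuous f) (hg : Continuous g)
    (h : ∀ a : ι →₀ 𝕜, f (Finsupp.linearCombination 𝕜 x a) ≤ g (Finsupp.linearCombination 𝕜 x a)) :
    ∀ v ∈ (Submodule.span 𝕜 (range x)).topologicalClosure, f v ≤ g v := by
  intro v hv
  refine closure_minimal (t := {v | f v ≤ g v}) (fun w hw => ?_) (isClosed_le hf hg) hv
  obtain ⟨a, rfl⟩ := Finsupp.mem_span_range_iff_exists_finsupp.1 hw
  exact h a

theorem exists_linearIndependent_mem_of_mem_infDimSubspaces {Z : Submodule 𝕜 X}
    (hZ : Z ∈ infDimSubspaces 𝕜 X) : ∃ x : ℕ → X, LinearIndependent 𝕜 x ∧ ∀ i, x i ∈ Z := by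
  let b := Module.Basis.ofVectorSpace 𝕜 Z
  have hinf : Infinite (Module.Basis.ofVectorSpaceIndex 𝕜 Z) := by
    by_contra hfin
    rw [not_infinite_iff_finite] at hfin
    exact hZ.2 (Module.Basis.finiteDimensional_of_finite b)
  let e := Infinite.natEmbedding (Module.Basis.ofVectorSpaceIndex 𝕜 Z)
  exact ⟨fun i => b (e i), (b.linearIndependent.comp e e.injective).map' Z.subtype
    (Submodule.ker_subtype Z), fun i => (b (e i)).2⟩

theorem linearCombination_mem {ι : Type*} {x : ι → X} {Z : Submodule 𝕜 X} (hx : ∀ i, x i ∈ Z)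
    (a : ι →₀ 𝕜) : Finsupp.linearCombination 𝕜 x a ∈ Z :=
  Z.sum_mem fun i _ => Z.smul_mem _ (hx i)

theorem isEmbedding_comp_subtypeL_iff (T : X →L[𝕜] Y) (Z : Submodule 𝕜 X) :
    IsEmbedding (T.comp Z.subtypeL) ↔ ∃ n : ℕ, ∀ z ∈ Z, ‖z‖ ≤ n * ‖T z‖ := by
  constructor
  · intro h
    have h0 : {z : Z | ‖z‖ < 1} ∈ 𝓝 (0 : Z) := by
      simpa [Metric.ball, dist_zero_right] using Metric.ball_mem_nhds (0 : Z) one_pos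
    rw [h.nhds_eq_comap, map_zero, (Metric.nhds_basis_ball.comap _).mem_iff] at h0
    obtain ⟨δ, hδ, hsub⟩ := h0
    obtain ⟨n, hn⟩ := exists_nat_gt δ⁻¹
    refine ⟨n, fun z hz => ?_⟩
    by_contra! hlt
    have hz0 : 0 < ‖z‖ := lt_of_le_of_lt (by positivity) hlt
    -- Normalize `z`: the vector `z / ‖z‖` has norm one, but its image has norm less than `δ`.
    let w : Z := ((‖z‖⁻¹ : ℝ) : 𝕜) • ⟨z, hz⟩
    have hw : ‖w‖ = 1 := by
      change ‖((‖z‖⁻¹ : ℝ) : 𝕜) • z‖ = 1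
      rw [norm_smul, RCLike.norm_ofReal, abs_of_nonneg (by positivity), inv_mul_cancel₀ hz0.ne']
    have hTw : ‖T w‖ = ‖z‖⁻¹ * ‖T z‖ := by
      change ‖T (((‖z‖⁻¹ : ℝ) : 𝕜) • z)‖ = _
      rw [map_smul, norm_smul, RCLike.norm_ofReal, abs_of_nonneg (by positivity)]
    have hlt' : ‖T w‖ < δ := by
      have hn0 : (0 : ℝ) < n := (inv_pos.2 hδ).trans hn
      rw [hTw, inv_mul_lt_iff₀ hz0]
      have h1 : δ⁻¹ * ‖T z‖ < ‖z‖ :=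
        (mul_le_mul_of_nonneg_right hn.le (norm_nonneg _)).trans_lt hlt
      rw [inv_mul_lt_iff₀ hδ] at h1
      linarith [mul_comm ‖z‖ δ]
    have hmem : w ∈ {z : Z | ‖z‖ < 1} := hsub (by simpa using hlt')
    exact (hw ▸ (show ‖w‖ < 1 from hmem)).false
  · rintro ⟨n, hn⟩
    have hanti : AntilipschitzWith n (T.comp Z.subtypeL) :=
      AddMonoidHomClass.antilipschitz_of_bound _ fun z => by simpa using hn z z.2
    exact (hanti.isUniformEmbedding (T.comp Z.subtypeL).uniformContinuous).isEmbedding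

/-- An operator is not strictly singular iff it is bounded below on the span of some linearly
independent sequence. -/
theorem not_isStrictlySingular_iff (T : X →L[𝕜] Y) :
    ¬ IsStrictlySingular T ↔ ∃ n : ℕ, ∃ x : ℕ → X, LinearIndependent 𝕜 x ∧
      ∀ a : ℕ →₀ 𝕜, ‖Finsupp.linearCombination 𝕜 x a‖ ≤
        n * ‖T (Finsupp.linearCombination 𝕜 x a)‖ := by
  simp only [IsStrictlySingular, not_forall, not_not, isEmbedding_comp_subtypeL_iff]
  constructor
  · rintro ⟨Z, hZ, n, hn⟩
    obtain ⟨x, hx, hxZ⟩ := exists_linearIndependent_mem_of_mem_infDimSubspaces hZ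
    exact ⟨n, x, hx, fun a => hn _ (linearCombination_mem hxZ a)⟩
  · rintro ⟨n, x, hx, hn⟩
    exact ⟨_, topologicalClosure_span_range_mem_infDimSubspaces hx, n,
      forall_mem_topologicalClosure_span_le (by fun_prop) (by fun_prop) hn⟩

/-- The condition `‖T|_Z‖ < ε` for some `Z ∈ Subs(X)` and each `ε`, in terms of linearly independent
sequences. -/
theorem forall_exists_norm_comp_subtypeL_lt_iff (T : X →L[𝕜] Y) :
    (∀ ε : ℝ, 0 < ε → ∃ Z ∈ infDimSubspaces 𝕜 X, ‖T.comp Z.subtypeL‖ < ε) ↔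
      ∀ n : ℕ, ∃ x : ℕ → X, LinearIndependent 𝕜 x ∧
        ∀ a : ℕ →₀ 𝕜, ‖T (Finsupp.linearCombination 𝕜 x a)‖ ≤
          1 / ((n : ℝ) + 1) * ‖Finsupp.linearCombination 𝕜 x a‖ := by
  constructor
  · intro h n
    obtain ⟨Z, hZ, hlt⟩ := h (1 / ((n : ℝ) + 1)) Nat.one_div_pos_of_nat
    obtain ⟨x, hx, hxZ⟩ := exists_linearIndependent_mem_of_mem_infDimSubspaces hZ
    exact ⟨x, hx, fun a =>
      (T.comp Z.subtypeL).le_of_opNorm_le hlt.le ⟨_, linearCombination_mem hxZ a⟩⟩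
  · intro h ε hε
    obtain ⟨n, hn⟩ := exists_nat_one_div_lt hε
    obtain ⟨x, hx, hle⟩ := h n
    refine ⟨_, topologicalClosure_span_range_mem_infDimSubspaces hx, lt_of_le_of_lt ?_ hn⟩
    refine ContinuousLinearMap.opNorm_le_bound _ (by positivity) fun z => ?_
    exact forall_mem_topologicalClosure_span_le (f := fun v => ‖T v‖)
      (g := fun v => 1 / ((n : ℝ) + 1) * ‖v‖) (by fun_prop) (by fun_prop) hle z z.2

/-! ### A Polish parametrization of the unit ball -/

variable (𝕜 X Y) in
/-- The closed unit ball of `L(X,Y)` is the image of a Polish space under a map for which evaluation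
is jointly continuous. The parameters are the sequences of values that an operator of norm at most
one can take on a fixed dense sequence of `X`. -/
theorem exists_polish_parametrization_closedBall [TopologicalSpace.SeparableSpace X]
    [CompleteSpace Y] [TopologicalSpace.SeparableSpace Y] :
    ∃ (P : Set (ℕ → Y)) (_ : PolishSpace P) (T : P → Metric.closedBall (0 : X →L[𝕜] Y) 1),
      Continuous (fun q : P × X => (T q.1).1 q.2) ∧ Function.Surjective T := by
  let d := TopologicalSpace.denseSeq X
  have hd : DenseRange d := TopologicalSpace.denseRange_denseSeq X
  have hdense : DenseRange (Finsupp.linearCombination 𝕜 d) :=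
    hd.mono (by rintro _ ⟨n, rfl⟩; exact ⟨Finsupp.single n 1, by simp⟩)
  let P : Set (ℕ → Y) := {g | ∀ a : ℕ →₀ 𝕜,
    ‖Finsupp.linearCombination 𝕜 g a‖ ≤ 1 * ‖Finsupp.linearCombination 𝕜 d a‖}
  have hP : IsClosed P := by
    simp only [P, ofPred_forall]
    refine isClosed_iInter fun a => isClosed_le ?_ continuous_const
    simp only [Finsupp.linearCombination_apply, Finsupp.sum]
    fun_prop
  let T : P → Metric.closedBall (0 : X →L[𝕜] Y) 1 := fun g =>
    ⟨(Finsupp.linearCombination 𝕜 g.1).extendOfNorm (Finsupp.linearCombination 𝕜 d), by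
      rw [mem_closedBall_zero_iff]
      exact LinearMap.opNorm_extendOfNorm_le hdense zero_le_one g.2⟩
  have hTd : ∀ (g : P) n, (T g).1 (d n) = g.1 n := fun g n => by
    have := LinearMap.extendOfNorm_eq (f := Finsupp.linearCombination 𝕜 g.1) hdense ⟨1, g.2⟩
      (Finsupp.single n 1)
    simpa using this
  have hle : ∀ (g : P) (x y : X), dist ((T g).1 x) ((T g).1 y) ≤ dist x y := fun g x y => by
    rw [dist_eq_norm, dist_eq_norm, ← map_sub]
    simpa using (T g).1.le_of_opNorm_le (mem_closedBall_zero_iff.1 (T g).2) (x - y)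
  refine ⟨P, hP.polishSpace, T, ?_, fun S => ?_⟩
  · refine continuous_prod_of_continuous_lipschitzWith' _ 1
      (fun g => LipschitzWith.of_dist_le_mul fun x y => by simpa using hle g x y) fun x => ?_
    -- Evaluation at `x` is a uniform limit of evaluations at terms of the dense sequence.
    refine continuous_of_uniform_approx_of_continuous fun u hu => ?_
    obtain ⟨ε, hε, hεu⟩ := Metric.mem_uniformity_dist.1 hu
    obtain ⟨n, hn⟩ := hd.exists_dist_lt x hε
    refine ⟨fun g => g.1 n, (continuous_apply n).comp continuous_subtype_val,
      fun g => hεu ?_⟩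
    change dist ((T g).1 x) (g.1 n) < ε
    rw [← hTd]
    exact (hle g _ _).trans_lt hn
  · have hS : (fun n => S.1 (d n)) ∈ P := fun a => by
      have : Finsupp.linearCombination 𝕜 (fun n => S.1 (d n)) a =
          S.1 (Finsupp.linearCombination 𝕜 d a) := by
        simp [Finsupp.linearCombination_apply, Finsupp.sum]
      rw [this]
      exact S.1.le_of_opNorm_le (mem_closedBall_zero_iff.1 S.2) _
    refine ⟨⟨_, hS⟩, Subtype.ext ?_⟩
    exact ContinuousLinearMap.coeFn_injective
      (hd.equalizer (T ⟨_, hS⟩).1.continuous S.1.continuous (funext fun n => hTd ⟨_, hS⟩ n))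

/-! ### Analyticity of the strictly singular operators and of their complement -/

theorem measurableSet_setOf_linearIndependent [CompleteSpace X]
    [MeasurableSpace (ℕ → X)] [BorelSpace (ℕ → X)] :
    MeasurableSet {x : ℕ → X | LinearIndependent 𝕜 x} := by
  have : {x : ℕ → X | LinearIndependent 𝕜 x} =
      ⋂ s : Finset ℕ, {x : ℕ → X | LinearIndependent 𝕜 (x ∘ (Subtype.val : s → ℕ))} := by
    ext x
    simp only [mem_ofPred_eq, mem_iInter]
    exact linearIndependent_iff_finset_linearIndependent
  rw [this]
  refine MeasurableSet.iInter fun s => IsOpen.measurableSet ?_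
  exact (isOpen_setOfPred_linearIndependent (𝕜 := 𝕜) (E := X) (ι := s)).preimage
    (f := fun x : ℕ → X => x ∘ (Subtype.val : s → ℕ)) (by fun_prop)

/-- Projecting along linearly independent sequences: a family of closed conditions on the operator
and on the combinations of the sequence defines an analytic set of parameters. -/
theorem analyticSet_exists_linearIndependent [CompleteSpace X] [TopologicalSpace.SeparableSpace X]
    {P : Type*} [TopologicalSpace P] [PolishSpace P] (C : Set (P × X)) (hC : IsClosed C) :
    AnalyticSet {p | ∃ x : ℕ → X, LinearIndependent 𝕜 x ∧
      ∀ a : ℕ →₀ 𝕜, (p, Finsupp.linearCombination 𝕜 x a) ∈ C} := by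
  have hpol : PolishSpace X := inferInstance
  let D : Set (P × (ℕ → X)) := {q | LinearIndependent 𝕜 q.2 ∧
      ∀ a : ℕ →₀ 𝕜, (q.1, Finsupp.linearCombination 𝕜 q.2 a) ∈ C}
  have hD : AnalyticSet D := by
    borelize (P × (ℕ → X)) (ℕ → X)
    have h1 : MeasurableSet {q : P × (ℕ → X) | LinearIndependent 𝕜 q.2} :=
      measurableSet_setOf_linearIndependent.preimage continuous_snd.measurable
    have h2 : IsClosed {q : P × (ℕ → X) |
        ∀ a : ℕ →₀ 𝕜, (q.1, Finsupp.linearCombination 𝕜 q.2 a) ∈ C} := by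
      rw [ofPred_forall]
      refine isClosed_iInter fun a => hC.preimage ?_
      simp only [Finsupp.linearCombination_apply, Finsupp.sum]
      fun_prop
    exact (h1.inter h2.measurableSet).analyticSet
  convert hD.image_of_continuous continuous_fst using 1
  ext p
  constructor
  · rintro ⟨x, hx⟩
    exact ⟨(p, x), hx, rfl⟩
  · rintro ⟨⟨p, x⟩, hx, rfl⟩
    exact ⟨x, hx⟩

section

variable [CompleteSpace X] [TopologicalSpace.SeparableSpace X]
  {P : Type*} [TopologicalSpace P] [PolishSpace P] {T : P → X →L[𝕜] Y}

theorem analyticSet_isStrictlySingular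
    (hSS : ∀ R : X →L[𝕜] Y, IsStrictlySingular R ↔
      ∀ ε : ℝ, 0 < ε → ∃ Z ∈ infDimSubspaces 𝕜 X, ‖R.comp Z.subtypeL‖ < ε)
    (hT : Continuous fun q : P × X => T q.1 q.2) :
    AnalyticSet {p | IsStrictlySingular (T p)} := by
  simp only [hSS, forall_exists_norm_comp_subtypeL_lt_iff]
  rw [ofPred_forall]
  refine AnalyticSet.iInter fun n => analyticSet_exists_linearIndependent
    {q : P × X | ‖T q.1 q.2‖ ≤ 1 / ((n : ℝ) + 1) * ‖q.2‖} (isClosed_le ?_ ?_)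
  · exact hT.norm
  · fun_prop

theorem analyticSet_not_isStrictlySingular (hT : Continuous fun q : P × X => T q.1 q.2) :
    AnalyticSet {p | ¬ IsStrictlySingular (T p)} := by
  simp only [not_isStrictlySingular_iff]
  rw [ofPred_exists]
  refine AnalyticSet.iUnion fun n => analyticSet_exists_linearIndependent
    {q : P × X | ‖q.2‖ ≤ n * ‖T q.1 q.2‖} (isClosed_le ?_ ?_)
  · fun_prop
  · exact continuous_const.mul hT.norm

end

variable (𝕜 X Y) in
theorem continuous_ballSOT_eval (x : X) :
    @Continuous _ _ (ballSOT 𝕜 X Y) _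
      fun T : Metric.closedBall (0 : X →L[𝕜] Y) 1 => T.1 x := by
  let := ballSOT 𝕜 X Y
  exact (continuous_eval_const (F := PointwiseConvergenceCLM (RingHom.id 𝕜) X Y) x).comp
    continuous_induced_dom

variable (𝕜 X Y) in
theorem t2Space_ballSOT : @T2Space _ (ballSOT 𝕜 X Y) := by
  let := ballSOT 𝕜 X Y
  refine T2Space.of_injective_continuous
    (f := fun (T : Metric.closedBall (0 : X →L[𝕜] Y) 1) (x : X) => T.1 x) (fun S T h => ?_)
    (continuous_pi fun x => continuous_ballSOT_eval 𝕜 X Y x)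
  exact Subtype.ext (ContinuousLinearMap.coeFn_injective h)

theorem measurableSet_ballSS [CompleteSpace X] [TopologicalSpace.SeparableSpace X]
    [CompleteSpace Y] [TopologicalSpace.SeparableSpace Y]
    (hSS : ∀ R : X →L[𝕜] Y, IsStrictlySingular R ↔
      ∀ ε : ℝ, 0 < ε → ∃ Z ∈ infDimSubspaces 𝕜 X, ‖R.comp Z.subtypeL‖ < ε) :
    @MeasurableSet _ (@borel _ (ballSOT 𝕜 X Y)) (ballSS 𝕜 X Y) := by
  obtain ⟨P, hP, T, hT, hsurj⟩ := exists_polish_parametrization_closedBall 𝕜 X Y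
  let t := ballSOT 𝕜 X Y
  have hcont : @Continuous _ _ _ t T := by
    refine continuous_induced_rng.2 (PointwiseConvergenceCLM.continuous_of_continuous_eval ?_)
    exact fun x => hT.comp (Continuous.prodMk_left x)
  have h1 : @AnalyticSet _ t (ballSS 𝕜 X Y) := by
    have := (analyticSet_isStrictlySingular (T := fun p => (T p).1) hSS hT).image_of_continuous hcont
    rwa [show {p | IsStrictlySingular (T p).1} = T ⁻¹' ballSS 𝕜 X Y from rfl,
      image_preimage_eq _ hsurj] at this
  have h2 : @AnalyticSet _ t (ballSS 𝕜 X Y)ᶜ := by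
    have := (analyticSet_not_isStrictlySingular (T := fun p => (T p).1) hT).image_of_continuous hcont
    rwa [show {p | ¬ IsStrictlySingular (T p).1} = T ⁻¹' (ballSS 𝕜 X Y)ᶜ from rfl,
      image_preimage_eq _ hsurj] at this
  exact @AnalyticSet.measurableSet_of_compl _ t (t2Space_ballSOT 𝕜 X Y) (@borel _ t)
    (@BorelSpace.opensMeasurable _ t (@borel _ t) (@BorelSpace.mk _ t (@borel _ t) rfl)) _ h1 h2

/-! ### Perturbing basic sequences into a dense sequence -/

/-- The constant comes from the norm of the `n`-th coordinate functional. -/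
theorem IsNormalizedBasicSeq.exists_norm_coeff_le {x : ℕ+ → X} (hx : IsNormalizedBasicSeq 𝕜 x)
    (n : ℕ+) :
    ∃ C : ℝ, 0 < C ∧ ∀ a : ℕ+ →₀ 𝕜, ‖a n‖ ≤ C * ‖Finsupp.linearCombination 𝕜 x a‖ := by
  obtain ⟨-, b, hb⟩ := hx
  refine ⟨‖b.coord n‖ + 1, by positivity, fun a => ?_⟩
  have h1 : ((Finsupp.linearCombination 𝕜 b a : closedSpan 𝕜 x univ) : X) =
      Finsupp.linearCombination 𝕜 x a := by
    simp [Finsupp.linearCombination_apply, Finsupp.sum, hb]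
  have h2 : b.coord n (Finsupp.linearCombination 𝕜 b a) = a n := by
    simp [Finsupp.linearCombination_apply, Finsupp.sum, b.ortho, Pi.single_apply, eq_comm]
  rw [← h2, ← h1]
  exact (b.coord n).le_of_opNorm_le (by linarith) _

/-- A basic sequence can be approximated by terms of a dense sequence up to a small relative error
on all finite linear combinations. Only the continuity of the coordinate functionals is used: the
error allowed in the `n`-th term depends on the norm of the `n`-th functional. -/
theorem IsNormalizedBasicSeq.exists_perturbation {x : ℕ+ → X} (hx : IsNormalizedBasicSeq 𝕜 x)
    {d : ℕ → X} (hd : DenseRange d) {η : ℝ} (hη : 0 < η) :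
    ∃ φ : ℕ+ → ℕ, ∀ a : ℕ+ →₀ 𝕜,
      ‖Finsupp.linearCombination 𝕜 x a - Finsupp.linearCombination 𝕜 (d ∘ φ) a‖ ≤
        η * ‖Finsupp.linearCombination 𝕜 x a‖ := by
  choose C hC hCa using hx.exists_norm_coeff_le
  obtain ⟨δ, hδ, hsum⟩ := (countable_univ (α := ℕ+)).exists_pos_forall_sum_le hη
  choose φ hφ using fun n => hd.exists_dist_lt (x n) (div_pos (hδ n) (hC n))
  refine ⟨φ, fun a => ?_⟩
  set N := ‖Finsupp.linearCombination 𝕜 x a‖ with hN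
  calc ‖Finsupp.linearCombination 𝕜 x a - Finsupp.linearCombination 𝕜 (d ∘ φ) a‖
      = ‖∑ n ∈ a.support, a n • (x n - d (φ n))‖ := by
        simp [Finsupp.linearCombination_apply, Finsupp.sum, smul_sub]
    _ ≤ ∑ n ∈ a.support, δ n * N := by
        refine norm_sum_le_of_le _ fun n _ => ?_
        rw [norm_smul, ← dist_eq_norm]
        calc ‖a n‖ * dist (x n) (d (φ n)) ≤ (C n * N) * (δ n / C n) :=
              mul_le_mul (hCa n a) (hφ n).le dist_nonneg
                (mul_nonneg (hC n).le (norm_nonneg _))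
          _ = δ n * N := by field_simp [(hC n).ne']
    _ = (∑ n ∈ a.support, δ n) * N := (Finset.sum_mul _ _ _).symm
    _ ≤ η * N := mul_le_mul_of_nonneg_right (hsum _ (subset_univ _)) (norm_nonneg _)

theorem IsNormalizedBasicSeq.linearIndependent {x : ℕ+ → X} (hx : IsNormalizedBasicSeq 𝕜 x) :
    LinearIndependent 𝕜 x := by
  refine linearIndependent_iff.2 fun a ha => Finsupp.ext fun n => ?_
  obtain ⟨C, -, hC⟩ := hx.exists_norm_coeff_le n
  simpa [ha] using hC a

theorem LinearIndependent.of_norm_linearCombination_sub_le {ι : Type*} {x y : ι → X}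
    (hx : LinearIndependent 𝕜 x) {η : ℝ} (hη : η < 1)
    (h : ∀ a : ι →₀ 𝕜, ‖Finsupp.linearCombination 𝕜 x a - Finsupp.linearCombination 𝕜 y a‖ ≤
      η * ‖Finsupp.linearCombination 𝕜 x a‖) : LinearIndependent 𝕜 y := by
  refine linearIndependent_iff.2 fun a ha => linearIndependent_iff.1 hx a ?_
  have := h a
  rw [ha, sub_zero] at this
  by_contra h0
  nlinarith [norm_pos_iff.2 h0]

/-! ### The uniform bound for the Schreier indices -/

/-- `IsGoodIndexSet d k T E`: the vectors `d n`, `n ∈ E`, are linearly independent and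
`‖v‖ ≤ k * ‖T v‖` for all `v` in their span. -/
def IsGoodIndexSet (d : ℕ → X) (k : ℕ) (T : X →L[𝕜] Y) (E : Finset ℕ) : Prop :=
  LinearIndepOn 𝕜 d (E : Set ℕ) ∧
    ∀ v ∈ Submodule.span 𝕜 (d '' (E : Set ℕ)), ‖v‖ ≤ k * ‖T v‖

theorem IsGoodIndexSet.mono {d : ℕ → X} {k : ℕ} {T : X →L[𝕜] Y} {E E' : Finset ℕ} (h : E ⊆ E')
    (hE' : IsGoodIndexSet d k T E') : IsGoodIndexSet d k T E :=
  ⟨hE'.1.mono (Finset.coe_subset.2 h),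
    fun v hv => hE'.2 v (Submodule.span_mono (image_mono (Finset.coe_subset.2 h)) hv)⟩

theorem isClosed_setOf_isGoodIndexSet {P : Type*} [TopologicalSpace P] {T : P → X →L[𝕜] Y}
    (hT : Continuous fun q : P × X => T q.1 q.2) (d : ℕ → X) (k : ℕ) (E : Finset ℕ) :
    IsClosed {p | IsGoodIndexSet d k (T p) E} := by
  refine isClosed_const.and ?_
  simp only [ofPred_forall]
  exact isClosed_iInter fun v => isClosed_iInter fun _ => isClosed_le continuous_const
    (continuous_const.mul (hT.comp (Continuous.prodMk_left v)).norm)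

theorem not_exists_strictMono_isGoodIndexSet {d : ℕ → X} {k : ℕ} {T : X →L[𝕜] Y}
    (hT : IsStrictlySingular T) :
    ¬ ∃ E : ℕ → Finset ℕ, StrictMono E ∧ ∀ i, IsGoodIndexSet d k T (E i) := by
  rintro ⟨E, hE, hgood⟩
  refine (not_isStrictlySingular_iff T).2 ?_ hT
  let A : Set ℕ := ⋃ i, (E i : Set ℕ)
  have hmono : Monotone fun i => (E i : Set ℕ) := fun i j hij => Finset.coe_subset.2 (hE.monotone hij)
  have hA : LinearIndepOn 𝕜 d A :=
    linearIndepOn_iUnion_of_directed hmono.directed_le fun i => (hgood i).1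
  have hinf : A.Infinite := by
    intro hfin
    have hinj : Function.Injective fun i => (⟨E i, Finset.mem_powerset.2 fun n hn =>
        hfin.mem_toFinset.2 (mem_iUnion.2 ⟨i, hn⟩)⟩ : hfin.toFinset.powerset) :=
      fun i j hij => hE.injective (congrArg Subtype.val hij)
    exact not_injective_infinite_finite _ hinj
  have := hinf.to_subtype
  let e := Infinite.natEmbedding A
  refine ⟨k, fun n => d (e n), hA.comp e e.injective, fun a => ?_⟩
  choose i hi using fun n => mem_iUnion.1 (e n).2
  refine (hgood (a.support.sup i)).2 _ (Submodule.sum_mem _ fun n hn => Submodule.smul_mem _ _ ?_)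
  exact Submodule.subset_span ⟨e n, hmono (Finset.le_sup hn) (hi n), rfl⟩

/-- An operator bounded below on `[x_n]_{n ∈ F}` is bounded below, with constant `ε / 3` in
place of `ε`, on the span of a small perturbation. -/
theorem isGoodIndexSet_image {x : ℕ+ → X} (hx : LinearIndependent 𝕜 x) {d : ℕ → X} {φ : ℕ+ → ℕ}
    {T : X →L[𝕜] Y} (hT : ‖T‖ ≤ 1) {ε : ℝ} (hε : 0 < ε)
    (hφ : ∀ a : ℕ+ →₀ 𝕜,
      ‖Finsupp.linearCombination 𝕜 x a - Finsupp.linearCombination 𝕜 (d ∘ φ) a‖ ≤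
        min (1 / 2) (ε / 2) * ‖Finsupp.linearCombination 𝕜 x a‖)
    {k : ℕ} (hk : 3 / ε ≤ k) {F : Finset ℕ+}
    (hF : ∀ v ∈ closedSpan 𝕜 x (F : Set ℕ+), ε * ‖v‖ ≤ ‖T v‖) :
    IsGoodIndexSet d k T (F.image φ) := by
  have hy : LinearIndependent 𝕜 (d ∘ φ) :=
    hx.of_norm_linearCombination_sub_le ((min_le_left _ _).trans_lt one_half_lt_one) hφ
  rw [IsGoodIndexSet, Finset.coe_image]
  refine ⟨LinearIndepOn.image_of_comp φ d (hy.linearIndepOn _), fun v hv => ?_⟩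
  rw [← image_comp] at hv
  obtain ⟨a, ha, rfl⟩ := Finsupp.mem_span_image_iff_linearCombination 𝕜 |>.1 hv
  set u := Finsupp.linearCombination 𝕜 x a with hu
  set v := Finsupp.linearCombination 𝕜 (d ∘ φ) a with hv'
  have huF : u ∈ closedSpan 𝕜 x (F : Set ℕ+) := Submodule.le_topologicalClosure _
    ((Finsupp.mem_span_image_iff_linearCombination 𝕜).2 ⟨a, ha, rfl⟩)
  have h1 := hφ a
  have h2 : ‖u - v‖ ≤ 1 / 2 * ‖u‖ :=
    h1.trans (mul_le_mul_of_nonneg_right (min_le_left _ _) (norm_nonneg _))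
  have h3 : ‖u - v‖ ≤ ε / 2 * ‖u‖ :=
    h1.trans (mul_le_mul_of_nonneg_right (min_le_right _ _) (norm_nonneg _))
  have h4 : ‖T u‖ ≤ ‖T v‖ + ‖u - v‖ := by
    have h5 : ‖T (u - v)‖ ≤ ‖u - v‖ := by simpa using T.le_of_opNorm_le hT (u - v)
    rw [map_sub] at h5
    linarith [norm_sub_norm_le (T u) (T v)]
  have h6 := hF u huF
  have h7 : ‖v‖ ≤ 3 / 2 * ‖u‖ := by
    have := norm_sub_norm_le v u
    rw [norm_sub_rev] at this
    linarith
  calc ‖v‖ ≤ 3 / ε * (ε / 2 * ‖u‖) := by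
        rw [show 3 / ε * (ε / 2 * ‖u‖) = 3 / 2 * ‖u‖ by field_simp]
        exact h7
    _ ≤ 3 / ε * ‖T v‖ := mul_le_mul_of_nonneg_left (by linarith) (by positivity)
    _ ≤ k * ‖T v‖ := mul_le_mul_of_nonneg_right hk (norm_nonneg _)

/-- The strictly singular operators are all `S_ξ`-strictly singular for one countable `ξ`. -/
theorem exists_forall_isSchreierSS [CompleteSpace X] [TopologicalSpace.SeparableSpace X]
    [CompleteSpace Y] [TopologicalSpace.SeparableSpace Y]
    {s : Ordinal.{0} → ℕ+ → Ordinal.{0}} (hs : IsFundamentalSystem s)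
    (hSS : ∀ R : X →L[𝕜] Y, IsStrictlySingular R ↔
      ∀ ε : ℝ, 0 < ε → ∃ Z ∈ infDimSubspaces 𝕜 X, ‖R.comp Z.subtypeL‖ < ε) :
    ∃ ξ < ω₁, 1 ≤ ξ ∧ ∀ T : X →L[𝕜] Y, IsStrictlySingular T → IsSchreierSS s ξ T := by
  obtain ⟨P, hP, S, hS, hsurj⟩ := exists_polish_parametrization_closedBall 𝕜 X Y
  let d := TopologicalSpace.denseSeq X
  have hd : DenseRange d := TopologicalSpace.denseRange_denseSeq X
  choose o ho hrank using fun k : ℕ =>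
    exists_uniform_rank_bound (analyticSet_isStrictlySingular (T := fun p => (S p).1) hSS hS)
      (fun p => IsGoodIndexSet d k (S p).1) (isClosed_setOf_isGoodIndexSet (T := fun p => (S p).1) hS d k)
      (fun p E E' h => IsGoodIndexSet.mono h)
      (fun p hp => not_exists_strictMono_isGoodIndexSet hp)
  have hξ : max 1 (⨆ k, o k) < ω₁ :=
    max_lt (Ordinal.one_lt_omega0.trans Ordinal.omega0_lt_omega_one)
      (Ordinal.iSup_lt_omega_one ho)
  refine ⟨_, hξ, le_max_left _ _, fun T hT => ?_⟩
  by_contra hnot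
  simp only [IsSchreierSS] at hnot
  push Not at hnot
  obtain ⟨ε, hε, x, hx, hlow⟩ := hnot
  -- Rescale `T` into the unit ball.
  set c : ℝ := (‖T‖ + 1)⁻¹ with hc
  have hc0 : 0 < c := by positivity
  have hc1 : c ≤ 1 := inv_le_one_of_one_le₀ (by linarith [norm_nonneg T])
  have hnorm : ∀ v, ‖((c : 𝕜) • T) v‖ = c * ‖T v‖ := fun v => by
    rw [smul_apply, norm_smul, RCLike.norm_ofReal, abs_of_pos hc0]
  have hball : ‖(c : 𝕜) • T‖ ≤ 1 := by
    rw [norm_smul, RCLike.norm_ofReal, abs_of_pos hc0, hc, inv_mul_le_iff₀ (by positivity)]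
    linarith
  obtain ⟨p, hp⟩ := hsurj ⟨(c : 𝕜) • T, mem_closedBall_zero_iff.2 hball⟩
  have hp' : (S p).1 = (c : 𝕜) • T := congrArg Subtype.val hp
  have hpSS : IsStrictlySingular (S p).1 := by
    rw [hp']
    by_contra h
    obtain ⟨n, y, hy, hn⟩ := (not_isStrictlySingular_iff _).1 h
    refine (not_isStrictlySingular_iff T).2 ⟨n, y, hy, fun a => (hn a).trans ?_⟩ hT
    rw [hnorm]
    exact mul_le_mul_of_nonneg_left (mul_le_of_le_one_left (norm_nonneg _) hc1) (Nat.cast_nonneg n)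
  have hcε : 0 < c * ε := mul_pos hc0 hε
  obtain ⟨k, hk⟩ := exists_nat_ge (3 / (c * ε))
  obtain ⟨φ, hφ⟩ := hx.exists_perturbation hd (η := min (1 / 2) (c * ε / 2)) (by positivity)
  have hφinj : Function.Injective φ :=
    (hx.linearIndependent.of_norm_linearCombination_sub_le
      ((min_le_left _ _).trans_lt one_half_lt_one) hφ).injective.of_comp
  obtain ⟨ρ, hρ, hρlt⟩ := hrank k p hpSS
  have hgood : ∀ F ∈ schreier s (max 1 (⨆ k, o k)), IsGoodIndexSet d k (S p).1 (F.image φ) := by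
    intro F hF
    rw [hp']
    refine isGoodIndexSet_image hx.linearIndependent hball hcε hφ hk fun v hv => ?_
    rw [hnorm, mul_assoc]
    refine mul_le_mul_of_nonneg_left ?_ hc0.le
    rcases eq_or_ne v 0 with rfl | hv0
    · simp
    · exact hlow F hF v hv hv0
  have hle := le_rank_schreier hs hξ 1 (fun F => ρ (F.image φ)) fun F b _ hbF hFb _ =>
    hρ _ _ ((Finset.image_ssubset_image hφinj).2
      (Finset.ssubset_insert fun hb => (hFb b hb).false)) (hgood _ hbF)
  exact absurd ((hρlt _).trans_le ((Ordinal.le_iSup o k).trans (le_max_right 1 _))) hle.not_gt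

end

theorem proposition4p1
    {𝕜 : Type*} [RCLike 𝕜]
    (X : Type*) [NormedAddCommGroup X] [NormedSpace 𝕜 X] [CompleteSpace X]
    [TopologicalSpace.SeparableSpace X]
    (Y : Type*) [NormedAddCommGroup Y] [NormedSpace 𝕜 Y] [CompleteSpace Y]
    [TopologicalSpace.SeparableSpace Y]
    (s : Ordinal.{0} → ℕ+ → Ordinal.{0}) (hs : IsFundamentalSystem s)
    (hSS : ∀ R : X →L[𝕜] Y, IsStrictlySingular R ↔
      ∀ ε : ℝ, 0 < ε → ∃ Z ∈ infDimSubspaces 𝕜 X, ‖R.comp Z.subtypeL‖ < ε) :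
    @MeasurableSet _ (@borel _ (ballSOT 𝕜 X Y)) (ballSS 𝕜 X Y) ∧
      ssIndex 𝕜 X Y s < ω₁ := by
  refine ⟨measurableSet_ballSS hSS, ?_⟩
  obtain ⟨ξ, hξ, hξ1, h⟩ := exists_forall_isSchreierSS hs hSS
  refine lt_of_le_of_lt (ciSup_le' fun T => ?_) hξ
  exact csInf_le' (Or.inl ⟨hξ1, hξ, h T.1 T.2⟩)
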